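/- All graphs are finite and simple. A realisation of a graph $G=(V,E)$ in the plane is a map $p\colon V\to\mathbb{R}^2$; it is generic if its $2|V|$ coordinates are algebraically independent over $\mathbb{Q}$. A continuous motion of $(G,p)$ is a continuous map $\phi\colon(-1,1)\times V\to\mathbb{R}^2$, written $\phi_t(v)=\phi(t,v)$, such that $\phi_0=p$ and $\|\phi_t(u)-\phi_t(v)\|=\|p(u)-p(v)\|$ for every edge $uv\in E$ and every $t\in(-1,1)$, where $\|\cdot\|$ is the Euclidean norm; it is trivial if this equality holds for all $u,v\in V$ and all $t\in(-1,1)$. The realisation $(G,p)$ is flexible if it has a nontrivial continuous motion, and rigid otherwise. The graph $G$ is ($2$-)rigid if all its generic realisations in $\mathbb{R}^2$ are rigid, and ($2$-)flexible otherwise, that is, if some generic realisation of $G$ in $\mathbb{R}^2$ is flexible (equivalently, all of them are). A stable cut of $G$ is a (possibly empty) set $X\subseteq V$ of pairwise nonadjacent vertices such that $G-X$ is disconnected (i.e. has at least two connected components). Every flexible graph has a stable cut. -/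

import Mathlib

namespace GraphRigidity

/-- A realisation of a graph with vertex set `V` in `ℝ^d` (with the Euclidean norm). -/
abbrev Realisation (V : Type*) (d : ℕ) := V → EuclideanSpace ℝ (Fin d)

/-- Two realisations of `G` are equivalent if every edge of `G` has the same length in both. -/
def Equivalent {V : Type*} {d : ℕ} (G : SimpleGraph V) (p q : Realisation V d) : Prop :=
  ∀ u v : V, G.Adj u v → ‖p u - p v‖ = ‖q u - q v‖

/-- `φ` is a continuous motion of `(G, p)`. The time parameter runs through `(-1, 1)`; values of
`φ` outside this interval play no role. As `V` is discrete, joint continuity in `(t, v)` is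
continuity of `t ↦ φ t` for the product topology. -/
structure IsContinuousMotion {V : Type*} {d : ℕ} (G : SimpleGraph V) (p : Realisation V d)
    (φ : ℝ → Realisation V d) : Prop where
  continuousOn : ContinuousOn φ (Set.Ioo (-1 : ℝ) 1)
  initial : φ 0 = p
  equivalent : ∀ t ∈ Set.Ioo (-1 : ℝ) 1, Equivalent G p (φ t)

/-- A motion of `p` is trivial if all the realisations `φ t` are congruent to `p`, that is, all
pairwise distances of vertices agree. -/
def IsTrivialMotion {V : Type*} {d : ℕ} (p : Realisation V d) (φ : ℝ → Realisation V d) : Prop :=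
  ∀ t ∈ Set.Ioo (-1 : ℝ) 1, Congruent p (φ t)

/-- The framework `(G, p)` is flexible if it has a nontrivial continuous motion. -/
def IsFlexibleFramework {V : Type*} {d : ℕ} (G : SimpleGraph V) (p : Realisation V d) : Prop :=
  ∃ φ : ℝ → Realisation V d, IsContinuousMotion G p φ ∧ ¬ IsTrivialMotion p φ

/-- The framework `(G, p)` is rigid if it is not flexible. -/
def IsRigidFramework {V : Type*} {d : ℕ} (G : SimpleGraph V) (p : Realisation V d) : Prop :=
  ¬ IsFlexibleFramework G p

/-- A realisation is generic if its coordinates, indexed by pairs of a vertex and an axis, are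
algebraically independent over `ℚ`. -/
def IsGeneric {V : Type*} {d : ℕ} (p : Realisation V d) : Prop :=
  AlgebraicIndependent ℚ (fun x : V × Fin d => p x.1 x.2)

/-- `G` is `d`-rigid if its generic realisations in `ℝ^d` are rigid. -/
def IsRigidGraph {V : Type*} (d : ℕ) (G : SimpleGraph V) : Prop :=
  ∀ p : Realisation V d, IsGeneric p → IsRigidFramework G p

/-- `G` is `d`-flexible if it is not `d`-rigid, i.e. if some generic realisation in `ℝ^d` is
flexible. (For finite graphs either all or none of the generic realisations in `ℝ^d` are flexible,
so this is the same as all of them being flexible; formally it is the weaker requirement.) -/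
def IsFlexibleGraph {V : Type*} (d : ℕ) (G : SimpleGraph V) : Prop :=
  ¬ IsRigidGraph d G

/-- `X` is a cut of `G` if `G - X` is disconnected, i.e. has two vertices that are not joined by a
path. (`Preconnected` is used because the graph without vertices is not disconnected.) -/
def IsCut {V : Type*} (G : SimpleGraph V) (X : Set V) : Prop :=
  ¬ (G.induce Xᶜ).Preconnected

/-- A stable cut is a cut that is a set of pairwise nonadjacent vertices. -/
def IsStableCut {V : Type*} (G : SimpleGraph V) (X : Set V) : Prop :=
  G.IsIndepSet X ∧ IsCut G X

end GraphRigidity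

namespace GraphRigidity

/-! A stronger statement is proved by induction on the number of vertices: if a generic framework is
not infinitesimally rigid, then for every vertex x either some stable cut avoids x, or {x} itself is
a cut (`exists_separates_of_not_infRigid`). Prescribing x is what lets cuts be lifted through
contractions.

If x lies in no triangle, its neighbourhood is stable and separates x from any non-neighbour; if
there is none, G is a star centred at x, so x is a cut vertex or G is complete on at most two
vertices, hence rigid.

If xyz is a triangle, merge y into x. By vertex splitting (`InfRigid.of_contraction`) the smaller
framework is still not infinitesimally rigid. A stable cut of it avoiding x is a stable cut of G. If
instead x is a cut vertex of it, then {x, y} separates G. Two rigid sides could be glued along x and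
y (`InfRigid.glue`), so one side is not rigid, and induction applies to it. As xy is an edge, x and
y never lie on opposite sides of a cut, so the cut found extends to G (`Separates.of_induce`).

The passage from flexible to not infinitesimally rigid is `InfRigid.isRigidFramework`. -/

/-- The inner product of `p u - p v` and `q u - q v`, for plane frameworks given by coordinates. -/
def edgeForm {V : Type*} (p q : V × Fin 2 → ℝ) (u v : V) : ℝ :=
  (p (u, 0) - p (v, 0)) * (q (u, 0) - q (v, 0)) + (p (u, 1) - p (v, 1)) * (q (u, 1) - q (v, 1))

/-- `q` is an infinitesimal motion of the plane framework `(G, p)`. -/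
def IsInfMotion {V : Type*} (G : SimpleGraph V) (p q : V × Fin 2 → ℝ) : Prop :=
  ∀ u v, G.Adj u v → edgeForm p q u v = 0

/-- Every infinitesimal motion of `(G, p)` is an infinitesimal motion of the complete graph. -/
def InfRigid {V : Type*} (G : SimpleGraph V) (p : V × Fin 2 → ℝ) : Prop :=
  ∀ q, IsInfMotion G p q → ∀ u v, edgeForm p q u v = 0

/-- The only infinitesimal motion of `(G, p)` that fixes `x` and moves `y` vertically is zero. -/
def PinnedInfRigid {V : Type*} (G : SimpleGraph V) (p : V × Fin 2 → ℝ) (x y : V) : Prop :=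
  ∀ q, IsInfMotion G p q → q (x, 0) = 0 → q (x, 1) = 0 → q (y, 0) = 0 → q = 0

/-! ### Pinned infinitesimal rigidity as nonvanishing of a Gram determinant -/

section PinnedMatrix

variable {V : Type*} [DecidableEq V] {R S : Type*} [CommRing R] [CommRing S]

open Classical in
/-- The rigidity matrix of `G` for edge directions `D`, with three rows added that pin both
coordinates of `x` and the first coordinate of `y`. -/
noncomputable def pinnedMatrix (G : SimpleGraph V) (x y : V) (D : V → V → Fin 2 → R) :
    Matrix ((V × V) ⊕ Fin 3) (V × Fin 2) R :=
  Matrix.of <| Sum.elim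
    (fun e => if G.Adj e.1 e.2 then
      ∑ i, (Pi.single (e.1, i) (D e.1 e.2 i) - Pi.single (e.2, i) (D e.1 e.2 i)) else 0)
    ![Pi.single (x, 0) 1, Pi.single (x, 1) 1, Pi.single (y, 0) 1]

/-- The Gram determinant of the columns of the pinned rigidity matrix. -/
noncomputable def pinnedDet [Fintype V] (G : SimpleGraph V) (x y : V) (D : V → V → Fin 2 → R) : R :=
  ((pinnedMatrix G x y D).transpose * pinnedMatrix G x y D).det

lemma map_pinnedDet [Fintype V] (f : R →+* S) (G : SimpleGraph V) (x y : V)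
    (D : V → V → Fin 2 → R) :
    f (pinnedDet G x y D) = pinnedDet G x y (fun u v i => f (D u v i)) := by
  have h : (pinnedMatrix G x y D).map f = pinnedMatrix G x y (fun u v i => f (D u v i)) := by
    ext e c
    rcases e with e | k
    · simp only [pinnedMatrix, Matrix.map_apply, Matrix.of_apply, Sum.elim_inl]
      split_ifs
      · simp [Pi.single_apply, apply_ite f]
      · simp
    · fin_cases k <;> simp [pinnedMatrix, Pi.single_apply, apply_ite f]
  rw [pinnedDet, pinnedDet, RingHom.map_det, RingHom.mapMatrix_apply, Matrix.map_mul, ← h,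
    Matrix.transpose_map]

/-- Over the reals a matrix and its Gram matrix have the same kernel. The directions `D` need not
come from a placement, which vertex splitting exploits for an edge of length zero. -/
lemma pinnedDet_ne_zero_iff [Fintype V] (G : SimpleGraph V) (x y : V) (D : V → V → Fin 2 → ℝ) :
    pinnedDet G x y D ≠ 0 ↔ ∀ q : V × Fin 2 → ℝ,
      (∀ u v, G.Adj u v → ∑ i, D u v i * (q (u, i) - q (v, i)) = 0) →
      q (x, 0) = 0 → q (x, 1) = 0 → q (y, 0) = 0 → q = 0 := by
  have key : ∀ q : V × Fin 2 → ℝ,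
      ((pinnedMatrix G x y D).transpose * pinnedMatrix G x y D).mulVec q = 0 ↔
      (∀ u v, G.Adj u v → ∑ i, D u v i * (q (u, i) - q (v, i)) = 0) ∧
      q (x, 0) = 0 ∧ q (x, 1) = 0 ∧ q (y, 0) = 0 := by
    intro q
    have h := Matrix.ker_mulVecLin_transpose_mul_self (pinnedMatrix G x y D)
    have h' := SetLike.ext_iff.1 h q
    simp only [LinearMap.mem_ker, Matrix.mulVecLin_apply] at h'
    rw [h']
    have hrow : ∀ u v, G.Adj u v → (pinnedMatrix G x y D).mulVec q (Sum.inl (u, v)) =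
        ∑ i, D u v i * (q (u, i) - q (v, i)) := by
      intro u v huv
      have hr : pinnedMatrix G x y D (Sum.inl (u, v)) =
          ∑ i, (Pi.single (u, i) (D u v i) - Pi.single (v, i) (D u v i)) := if_pos huv
      change pinnedMatrix G x y D (Sum.inl (u, v)) ⬝ᵥ q = _
      rw [hr]
      simp only [sum_dotProduct, sub_dotProduct, single_dotProduct, mul_sub]
    constructor
    · intro hq
      refine ⟨fun u v huv => ?_, ?_, ?_, ?_⟩
      · rw [← hrow u v huv, hq]; rfl
      · simpa [Matrix.mulVec, pinnedMatrix] using congrFun hq (Sum.inr 0)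
      · simpa [Matrix.mulVec, pinnedMatrix] using congrFun hq (Sum.inr 1)
      · simpa [Matrix.mulVec, pinnedMatrix] using congrFun hq (Sum.inr 2)
    · rintro ⟨h0, h1, h2, h3⟩
      ext e
      rcases e with ⟨u, v⟩ | k
      · by_cases huv : G.Adj u v
        · rw [hrow u v huv, h0 u v huv]; rfl
        · simp [Matrix.mulVec, pinnedMatrix, huv]
      · fin_cases k <;> simp [Matrix.mulVec, pinnedMatrix, h1, h2, h3]
  rw [pinnedDet, Ne, ← Matrix.exists_mulVec_eq_zero_iff]
  constructor
  · intro h q h0 h1 h2 h3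
    by_contra hq
    exact h ⟨q, hq, (key q).2 ⟨h0, h1, h2, h3⟩⟩
  · rintro h ⟨q, hq, hq0⟩
    obtain ⟨h0, h1, h2, h3⟩ := (key q).1 hq0
    exact hq (h q h0 h1 h2 h3)

lemma continuous_pinnedDet [Fintype V] {T : Type*} [TopologicalSpace T] (G : SimpleGraph V)
    (x y : V) {D : T → V → V → Fin 2 → ℝ} (hD : ∀ u v i, Continuous fun t => D t u v i) :
    Continuous fun t => pinnedDet G x y (D t) := by
  have hM : Continuous fun t => pinnedMatrix G x y (D t) := by
    refine continuous_matrix fun e c => ?_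
    rcases e with e | k
    · simp only [pinnedMatrix, Matrix.of_apply, Sum.elim_inl]
      split_ifs
      · simp only [Finset.sum_apply, Pi.sub_apply, Pi.single_apply]
        refine continuous_finsetSum _ fun i _ => Continuous.sub ?_ ?_ <;> split_ifs <;>
          first | exact hD _ _ _ | exact continuous_const
      · exact continuous_const
    · exact continuous_const
  exact (hM.matrix_transpose.matrix_mul hM).matrix_det

lemma pinnedInfRigid_iff [Fintype V] (G : SimpleGraph V) (p : V × Fin 2 → ℝ) (x y : V) :
    PinnedInfRigid G p x y ↔ pinnedDet G x y (fun u v i => p (u, i) - p (v, i)) ≠ 0 := by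
  rw [pinnedDet_ne_zero_iff]
  simp [PinnedInfRigid, IsInfMotion, edgeForm]

end PinnedMatrix

lemma isOpen_pinnedInfRigid {V : Type*} [Finite V] (G : SimpleGraph V) (x y : V) :
    IsOpen {p | PinnedInfRigid G p x y} := by
  classical
  have := Fintype.ofFinite V
  simp only [pinnedInfRigid_iff]
  exact isOpen_ne_fun (continuous_pinnedDet G x y (by fun_prop)) continuous_const

lemma aeval_ne_zero_of_eval_ne_zero {ι : Type*} {p : ι → ℝ} (hp : AlgebraicIndependent ℚ p)
    {P : MvPolynomial ι ℚ} {s : ι → ℝ} (hs : MvPolynomial.aeval s P ≠ 0) :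
    MvPolynomial.aeval p P ≠ 0 := by
  intro h
  rw [hp.eq_zero_of_aeval_eq_zero P h] at hs
  simp at hs

/-- The Gram determinant is a rational polynomial in the coordinates. Being nonzero at one
placement, it is a nonzero polynomial, and so does not vanish at a generic point. -/
lemma PinnedInfRigid.of_generic {V : Type*} [Finite V] {G : SimpleGraph V}
    {p s : V × Fin 2 → ℝ} {x y : V} (hp : AlgebraicIndependent ℚ p)
    (hs : PinnedInfRigid G s x y) : PinnedInfRigid G p x y := by
  classical
  have := Fintype.ofFinite V
  have key : ∀ r : V × Fin 2 → ℝ, MvPolynomial.aeval r (pinnedDet G x y (fun u v i =>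
      (MvPolynomial.X (u, i) - MvPolynomial.X (v, i) : MvPolynomial (V × Fin 2) ℚ))) =
      pinnedDet G x y (fun u v i => r (u, i) - r (v, i)) := by
    intro r
    have := map_pinnedDet (MvPolynomial.aeval (R := ℚ) r).toRingHom G x y (fun u v i =>
      (MvPolynomial.X (u, i) - MvPolynomial.X (v, i) : MvPolynomial (V × Fin 2) ℚ))
    simpa using this
  rw [pinnedInfRigid_iff, ← key] at hs ⊢
  exact aeval_ne_zero_of_eval_ne_zero hp hs

/-! ### Generic placements; pinned versus unpinned rigidity -/

section Generic

variable {V : Type*} {p : V × Fin 2 → ℝ}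

lemma generic_ne (hp : AlgebraicIndependent ℚ p) {u v : V} (h : u ≠ v) (i : Fin 2) :
    p (u, i) ≠ p (v, i) :=
  fun he => h (congrArg Prod.fst (hp.injective he))

lemma generic_not_collinear (hp : AlgebraicIndependent ℚ p) {u v w : V} (huv : u ≠ v)
    (huw : u ≠ w) (hvw : v ≠ w) :
    (p (u, 0) - p (w, 0)) * (p (v, 1) - p (w, 1)) -
      (p (u, 1) - p (w, 1)) * (p (v, 0) - p (w, 0)) ≠ 0 := by
  classical
  have := aeval_ne_zero_of_eval_ne_zero hp
    (P := (MvPolynomial.X (u, 0) - MvPolynomial.X (w, 0)) *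
      (MvPolynomial.X (v, 1) - MvPolynomial.X (w, 1)) -
      (MvPolynomial.X (u, 1) - MvPolynomial.X (w, 1)) *
      (MvPolynomial.X (v, 0) - MvPolynomial.X (w, 0)))
    -- The placement u = (1, 0), v = (0, 1), w = (0, 0) has determinant 1.
    (s := fun c => if c = (u, 0) ∨ c = (v, 1) then 1 else 0)
    (by simp [huv, huw.symm, hvw.symm])
  simpa using this

/-- A vector orthogonal to two independent vectors vanishes. -/
lemma eq_zero_of_orthogonal {a b c d s t : ℝ} (hdet : a * d - b * c ≠ 0)
    (h1 : a * s + b * t = 0) (h2 : c * s + d * t = 0) : s = 0 ∧ t = 0 := by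
  constructor
  · exact (mul_eq_zero.1 (show (a * d - b * c) * s = 0 by linear_combination d * h1 - b * h2)
      ).resolve_left hdet
  · exact (mul_eq_zero.1 (show (a * d - b * c) * t = 0 by linear_combination a * h2 - c * h1)
      ).resolve_left hdet

lemma InfRigid.pinned {G : SimpleGraph V} (hp : AlgebraicIndependent ℚ p) (h : InfRigid G p)
    {x y : V} (hxy : x ≠ y) : PinnedInfRigid G p x y := by
  intro q hq h0 h1 h2
  have hall := h q hq
  have hy : q (y, 1) = 0 := by
    have := hall x y
    simp only [edgeForm, h0, h1, h2] at this
    have h3 := sub_ne_zero.2 (generic_ne hp hxy 1)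
    have h4 : (p (x, 1) - p (y, 1)) * q (y, 1) = 0 := by linarith
    exact (mul_eq_zero.1 h4).resolve_left h3
  have hz : ∀ u, q (u, 0) = 0 ∧ q (u, 1) = 0 := by
    intro u
    by_cases hux : u = x
    · subst hux; exact ⟨h0, h1⟩
    by_cases huy : u = y
    · subst huy; exact ⟨h2, hy⟩
    have hx := hall x u
    have hy' := hall y u
    simp only [edgeForm, h0, h1, h2, hy] at hx hy'
    refine eq_zero_of_orthogonal (generic_not_collinear hp hxy (Ne.symm hux) (Ne.symm huy)) ?_ ?_
      <;> linarith
  ext ⟨u, i⟩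
  fin_cases i
  · exact (hz u).1
  · exact (hz u).2

/-- Any motion can be normalised to a pinned one by subtracting a translation and a rotation about
x; these do not change `edgeForm`. The heights of x and y must differ for the rotation to control
the first coordinate at y. -/
lemma PinnedInfRigid.infRigid {G : SimpleGraph V} {x y : V} (h : PinnedInfRigid G p x y)
    (hxy : p (x, 1) ≠ p (y, 1)) : InfRigid G p := by
  intro q hq
  -- `c` is the angular velocity that cancels the horizontal velocity of y relative to x.
  obtain ⟨c, hc⟩ : ∃ c : ℝ, q (y, 0) - q (x, 0) + c * (p (y, 1) - p (x, 1)) = 0 := by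
    refine ⟨-(q (y, 0) - q (x, 0)) / (p (y, 1) - p (x, 1)), ?_⟩
    have := sub_ne_zero.2 hxy.symm
    field_simp
    ring
  set r : V × Fin 2 → ℝ := fun w =>
    if w.2 = 0 then q (w.1, 0) - q (x, 0) + c * (p (w.1, 1) - p (x, 1))
    else q (w.1, 1) - q (x, 1) - c * (p (w.1, 0) - p (x, 0)) with hr
  have hform : ∀ u v, edgeForm p r u v = edgeForm p q u v := by
    intro u v
    simp only [edgeForm, hr, if_true, one_ne_zero, if_false]
    ring
  have hr0 : r = 0 := by
    refine h r (fun u v huv => (hform u v).trans (hq u v huv)) ?_ ?_ ?_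
    · simp [hr]
    · simp [hr]
    · simpa [hr] using hc
  intro u v
  rw [← hform, hr0]
  simp [edgeForm]

end Generic


/-! ### Contraction and vertex splitting -/

section Contraction

variable {V : Type*} [DecidableEq V]

/-- The map that merges `y` into `x`. -/
def mergeMap (x y : V) (hxy : x ≠ y) (v : V) : {v // v ≠ y} :=
  if h : v = y then ⟨x, hxy⟩ else ⟨v, h⟩

lemma mergeMap_of_ne {x y : V} (hxy : x ≠ y) {v : V} (h : v ≠ y) :
    mergeMap x y hxy v = ⟨v, h⟩ := dif_neg h

lemma mergeMap_self {x y : V} (hxy : x ≠ y) : mergeMap x y hxy y = ⟨x, hxy⟩ := dif_pos rfl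

/-- The simple graph obtained from `G` by merging `y` into `x`. -/
def contraction (G : SimpleGraph V) (x y : V) (hxy : x ≠ y) : SimpleGraph {v // v ≠ y} where
  Adj a b := a ≠ b ∧ ∃ u v, G.Adj u v ∧ mergeMap x y hxy u = a ∧ mergeMap x y hxy v = b
  symm := ⟨fun _ _ ⟨hab, u, v, huv, hu, hv⟩ => ⟨hab.symm, v, u, huv.symm, hv, hu⟩⟩
  loopless := ⟨fun _ h => h.1 rfl⟩

lemma contraction_adj {G : SimpleGraph V} {x y : V} (hxy : x ≠ y) {u v : V} (h : G.Adj u v)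
    (hne : mergeMap x y hxy u ≠ mergeMap x y hxy v) :
    (contraction G x y hxy).Adj (mergeMap x y hxy u) (mergeMap x y hxy v) :=
  ⟨hne, u, v, h, rfl, rfl⟩

lemma contraction_adj_of_ne {G : SimpleGraph V} {x y : V} (hxy : x ≠ y) {u v : V} (h : G.Adj u v)
    (hu : u ≠ y) (hv : v ≠ y) : (contraction G x y hxy).Adj ⟨u, hu⟩ ⟨v, hv⟩ := by
  have := contraction_adj hxy h
  rw [mergeMap_of_ne hxy hu, mergeMap_of_ne hxy hv] at this
  exact this fun e => h.ne (congrArg Subtype.val e)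

/-- **Vertex splitting** in the plane, for generic frameworks. -/
lemma InfRigid.of_contraction [Finite V] {G : SimpleGraph V} {p : V × Fin 2 → ℝ}
    (hp : AlgebraicIndependent ℚ p) {x y z : V} (hxy : G.Adj x y) (hxz : G.Adj x z)
    (hyz : G.Adj y z)
    (h : InfRigid (contraction G x y hxy.ne) (fun c => p (c.1.1, c.2))) : InfRigid G p := by
  have := Fintype.ofFinite V
  set f := mergeMap x y hxy.ne with hf
  have hp' : AlgebraicIndependent ℚ (fun c : {v // v ≠ y} × Fin 2 => p (c.1.1, c.2)) :=
    hp.comp (fun c : {v // v ≠ y} × Fin 2 => (c.1.1, c.2)) fun a b hab => by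
      simp only [Prod.mk.injEq] at hab
      exact Prod.ext (Subtype.ext hab.1) hab.2
  have hpin := h.pinned hp' (x := ⟨x, hxy.ne⟩) (y := ⟨z, hyz.ne.symm⟩)
    fun e => hxz.ne (congrArg Subtype.val e)
  have hfx : f x = ⟨x, hxy.ne⟩ := mergeMap_of_ne _ _
  have hfy : f y = ⟨x, hxy.ne⟩ := mergeMap_self _
  have hfz : f z = ⟨z, hyz.ne.symm⟩ := mergeMap_of_ne _ _
  -- The placement of `y` moves from that of `x` (at `t = 0`) towards `p y`.
  let s : ℝ → V × Fin 2 → ℝ := fun t c =>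
    if c.1 = y then p (x, c.2) + t * (p (y, c.2) - p (x, c.2)) else p c
  -- The edge xy degenerates at t = 0, so its row keeps the direction of `p x - p y`; for t ≠ 0 this
  -- is a nonzero multiple of the true edge vector.
  let D : ℝ → V → V → Fin 2 → ℝ := fun t u v i =>
    if f u = f v then p (u, i) - p (v, i) else s t (u, i) - s t (v, i)
  have hs0 : ∀ u i, s 0 (u, i) = p ((f u).1, i) := by
    intro u i
    by_cases hu : u = y
    · subst hu; simp [s, hfy]
    · simp [s, hu, hf, mergeMap_of_ne _ hu]
  have hcont : Continuous fun t => pinnedDet G x z (D t) := by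
    refine continuous_pinnedDet G x z fun u v i => ?_
    simp only [D, s]
    split_ifs <;> fun_prop
  have h0 : pinnedDet G x z (D 0) ≠ 0 := by
    rw [pinnedDet_ne_zero_iff]
    intro q hq h1 h2 h3
    -- At t = 0 the edges xz and yz have the same direction, so the difference of the velocities of
    -- x and y is orthogonal to it, and also to `p x - p y`. These directions are independent, so x
    -- and y move together and `q` descends to the contraction.
    have hqxy : q (x, 0) - q (y, 0) = 0 ∧ q (x, 1) - q (y, 1) = 0 := by
      have e1 := hq x y hxy
      have e2 := hq x z hxz
      have e3 := hq y z hyz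
      have n1 : f x ≠ f z := by
        rw [hfx, hfz]; exact fun e => hxz.ne (congrArg Subtype.val e)
      have n2 : f y ≠ f z := by rw [hfy, ← hfx]; exact n1
      simp only [D, if_pos (hfx.trans hfy.symm), Fin.sum_univ_two] at e1
      simp only [D, if_neg n1, hs0, hfx, hfz, Fin.sum_univ_two] at e2
      simp only [D, if_neg n2, hs0, hfy, hfz, Fin.sum_univ_two] at e3
      refine eq_zero_of_orthogonal (a := p (x, 0) - p (y, 0)) (b := p (x, 1) - p (y, 1))
        (c := p (x, 0) - p (z, 0)) (d := p (x, 1) - p (z, 1)) ?_ e1 ?_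
      · have := generic_not_collinear hp hyz.ne hxy.ne.symm hxz.ne.symm
        intro h0
        exact this (by linear_combination h0)
      · linear_combination e2 - e3
    have hqf : ∀ u i, q (u, i) = q ((f u).1, i) := by
      intro u i
      by_cases hu : u = y
      · subst hu
        rw [hfy]
        fin_cases i
        · exact (sub_eq_zero.1 hqxy.1).symm
        · exact (sub_eq_zero.1 hqxy.2).symm
      · simp [hf, mergeMap_of_ne _ hu]
    have hq' : (fun c : {v // v ≠ y} × Fin 2 => q (c.1.1, c.2)) = 0 := by
      refine hpin _ ?_ h1 h2 h3
      rintro a b ⟨hab, u, v, huv, rfl, rfl⟩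
      have := hq u v huv
      rw [← hf] at hab ⊢
      simpa only [edgeForm, D, if_neg hab, hs0, hqf u, hqf v, Fin.sum_univ_two] using this
    ext ⟨u, i⟩
    rw [hqf]
    exact congrFun hq' (f u, i)
  obtain ⟨t, ht0, ht⟩ : ∃ t : ℝ, t ≠ 0 ∧ pinnedDet G x z (D t) ≠ 0 := by
    have h1 : ∀ᶠ t in nhdsWithin (0 : ℝ) {0}ᶜ, pinnedDet G x z (D t) ≠ 0 :=
      (hcont.continuousAt.eventually_ne h0).filter_mono nhdsWithin_le_nhds
    obtain ⟨t, ht, ht'⟩ := (h1.and self_mem_nhdsWithin).exists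
    exact ⟨t, ht', ht⟩
  have hst : PinnedInfRigid G (s t) x z := by
    rw [pinnedDet_ne_zero_iff] at ht
    intro q hq
    refine ht q fun u v huv => ?_
    have huv' := hq u v huv
    simp only [edgeForm] at huv'
    rw [Fin.sum_univ_two]
    by_cases hfuv : f u = f v
    · simp only [D, if_pos hfuv]
      by_cases hu : u = y
      · have hv : v = x := by
          have hvy : v ≠ y := fun e => huv.ne (hu.trans e.symm)
          rw [hu, hfy, hf, mergeMap_of_ne _ hvy] at hfuv
          exact (congrArg Subtype.val hfuv).symm
        subst hu hv
        simp only [s, if_true, hxy.ne, if_false] at huv'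
        refine (mul_eq_zero.1 (show t * _ = 0 from ?_)).resolve_left ht0
        linear_combination huv'
      · by_cases hv : v = y
        · have hu' : u = x := by
            rw [hv, hfy, hf, mergeMap_of_ne _ hu] at hfuv
            exact congrArg Subtype.val hfuv
          subst hu' hv
          simp only [s, if_true, hxy.ne, if_false] at huv'
          refine (mul_eq_zero.1 (show t * _ = 0 from ?_)).resolve_left ht0
          linear_combination huv'
        · rw [hf, mergeMap_of_ne _ hu, mergeMap_of_ne _ hv] at hfuv
          exact absurd (congrArg Subtype.val hfuv) huv.ne
    · simpa only [D, if_neg hfuv] using huv'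
  exact (hst.of_generic hp).infRigid (generic_ne hp hxz.ne 1)

end Contraction

/-- **Gluing** two rigid generic frameworks along two common vertices. -/
lemma InfRigid.glue {V : Type*} {G : SimpleGraph V} {p : V × Fin 2 → ℝ}
    (hp : AlgebraicIndependent ℚ p) {S T : Set V} (hST : S ∪ T = Set.univ) {x y : V}
    (hxy : x ≠ y) (hxS : x ∈ S) (hyS : y ∈ S) (hxT : x ∈ T) (hyT : y ∈ T)
    (hS : InfRigid (G.induce S) (fun c => p (c.1.1, c.2)))
    (hT : InfRigid (G.induce T) (fun c => p (c.1.1, c.2))) : InfRigid G p := by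
  refine PinnedInfRigid.infRigid (x := x) (y := y) (fun q hq h1 h2 h3 => ?_) (generic_ne hp hxy 1)
  -- Pinning at the shared vertices x and y forces a motion to vanish on each side separately.
  have key : ∀ U : Set V, x ∈ U → y ∈ U → InfRigid (G.induce U) (fun c => p (c.1.1, c.2)) →
      ∀ u ∈ U, ∀ i, q (u, i) = 0 := by
    intro U hx hy hU u hu i
    have hp' : AlgebraicIndependent ℚ (fun c : U × Fin 2 => p (c.1.1, c.2)) :=
      hp.comp (fun c : U × Fin 2 => (c.1.1, c.2)) fun a b hab => by
        simp only [Prod.mk.injEq] at hab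
        exact Prod.ext (Subtype.ext hab.1) hab.2
    have := hU.pinned hp' (x := ⟨x, hx⟩) (y := ⟨y, hy⟩)
      (fun e => hxy (congrArg Subtype.val e)) (fun c => q (c.1.1, c.2))
      (fun a b hab => hq a.1 b.1 hab) h1 h2 h3
    exact congrFun this (⟨u, hu⟩, i)
  ext ⟨u, i⟩
  rcases (hST ▸ Set.mem_univ u : u ∈ S ∪ T) with hu | hu
  · exact key S hxS hyS hS u hu i
  · exact key T hxT hyT hT u hu i

/-! ### Separations and their extension from induced subgraphs -/

section Separation

variable {V : Type*} {G : SimpleGraph V}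

/-- `X` separates the vertex set `C` from the remaining vertices, and neither part is empty. -/
structure Separates (G : SimpleGraph V) (X C : Set V) : Prop where
  disjoint : ∀ u ∈ C, u ∉ X
  nonempty : ∃ u, u ∈ C
  nonempty_compl : ∃ u, u ∉ C ∧ u ∉ X
  not_adj : ∀ u ∈ C, ∀ v, v ∉ C → v ∉ X → ¬ G.Adj u v

lemma Separates.symm {X C : Set V} (h : Separates G X C) :
    Separates G X {v | v ∉ C ∧ v ∉ X} where
  disjoint _ hu := hu.2
  nonempty := h.nonempty_compl
  nonempty_compl := by
    obtain ⟨u, hu⟩ := h.nonempty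
    exact ⟨u, fun h' => h'.1 hu, h.disjoint u hu⟩
  not_adj u hu v hv hvX huv := by
    have hvC : v ∈ C := by
      by_contra hvC
      exact hv ⟨hvC, hvX⟩
    exact h.not_adj v hvC u hu.1 hu.2 huv.symm

lemma Separates.isCut {X C : Set V} (h : Separates G X C) : IsCut G X := by
  intro hpre
  obtain ⟨a, ha⟩ := h.nonempty
  obtain ⟨b, hb, hbX⟩ := h.nonempty_compl
  have key : ∀ c d : (Xᶜ : Set V), (G.induce Xᶜ).Walk c d → c.1 ∈ C → d.1 ∈ C := by
    intro c d w
    induction w with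
    | nil => exact id
    | @cons u v _ huv _ ih =>
      intro hu
      refine ih ?_
      by_contra hv
      exact h.not_adj u.1 hu v.1 hv v.2 huv
  obtain ⟨w⟩ := hpre ⟨a, h.disjoint a ha⟩ ⟨b, hbX⟩
  exact hb (key _ _ w ha)

/-- A separation avoids two given adjacent vertices after passing to the other side if needed. -/
lemma Separates.exists_avoiding {X C : Set V} (h : Separates G X C) {x y : V} (hxy : G.Adj x y) :
    ∃ C', Separates G X C' ∧ x ∉ C' ∧ y ∉ C' := by
  by_cases hx : x ∈ C
  · refine ⟨_, h.symm, fun h' => h'.1 hx, fun h' => h.not_adj x hx y h'.1 h'.2 hxy⟩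
  · by_cases hy : y ∈ C
    · exact ⟨_, h.symm, fun h' => h.not_adj y hy x h'.1 h'.2 hxy.symm, fun h' => h'.1 hy⟩
    · exact ⟨C, h, hx, hy⟩

/-- If only the adjacent vertices `x`, `y` of `S` have neighbours outside `S`, a separation of the
graph induced on `S` extends to one of the whole graph. -/
lemma Separates.of_induce {S : Set V} {X C : Set S} (h : Separates (G.induce S) X C) {x y : V}
    (hxS : x ∈ S) (hyS : y ∈ S) (hxy : G.Adj x y)
    (hS : ∀ u ∈ S, u ≠ x → u ≠ y → ∀ v ∉ S, ¬ G.Adj u v) :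
    ∃ C', Separates G (Subtype.val '' X) C' := by
  obtain ⟨C', h', hx, hy⟩ :=
    h.exists_avoiding (x := (⟨x, hxS⟩ : S)) (y := ⟨y, hyS⟩) (by simpa using hxy)
  refine ⟨Subtype.val '' C', ?_, ?_, ?_, ?_⟩
  · rintro _ ⟨u, hu, rfl⟩ ⟨v, hv, hvu⟩
    exact h'.disjoint u hu (Subtype.ext hvu ▸ hv)
  · obtain ⟨u, hu⟩ := h'.nonempty
    exact ⟨u, u, hu, rfl⟩
  · obtain ⟨u, hu, huX⟩ := h'.nonempty_compl
    refine ⟨u, ?_, ?_⟩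
    · rintro ⟨v, hv, hvu⟩
      exact hu (Subtype.ext hvu ▸ hv)
    · rintro ⟨v, hv, hvu⟩
      exact huX (Subtype.ext hvu ▸ hv)
  · rintro _ ⟨u, hu, rfl⟩ v hv hvX huv
    by_cases hvS : v ∈ S
    · exact h'.not_adj u hu ⟨v, hvS⟩ (fun h => hv ⟨_, h, rfl⟩) (fun h => hvX ⟨_, h, rfl⟩)
        (by simpa using huv)
    · refine hS u.1 u.2 ?_ ?_ v hvS huv
      · rintro rfl; exact hx hu
      · rintro rfl; exact hy hu

end Separation

/-! ### The induction: stable cuts avoiding a vertex -/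

/-- In a generic framework that is not infinitesimally rigid, every vertex `x` is avoided by some
stable cut, unless `x` is a cut vertex. -/
theorem exists_separates_of_not_infRigid (n : ℕ) : ∀ {V : Type*} [Finite V] (_ : Nat.card V = n)
    (G : SimpleGraph V) (p : V × Fin 2 → ℝ) (_ : AlgebraicIndependent ℚ p)
    (_ : ¬ InfRigid G p) (x : V),
    (∃ X C : Set V, x ∉ X ∧ G.IsIndepSet X ∧ Separates G X C) ∨ ∃ C, Separates G {x} C := by
  classical
  induction n using Nat.strong_induction_on with
  | _ n ih =>
  intro V _ hn G p hp hG x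
  have hsub : ∀ S : Set V, AlgebraicIndependent ℚ (fun c : S × Fin 2 => p (c.1.1, c.2)) :=
    fun S => hp.comp (fun c : S × Fin 2 => (c.1.1, c.2)) fun a b hab => by
      simp only [Prod.mk.injEq] at hab
      exact Prod.ext (Subtype.ext hab.1) hab.2
  have hcard : ∀ S : Set V, ∀ v ∉ S, Nat.card S < n := by
    intro S v hv
    rw [← hn]
    exact Set.ncard_univ V ▸ Set.ncard_lt_ncard ((Set.ssubset_univ_iff).2 fun h =>
      hv (h ▸ Set.mem_univ v))
  by_cases htri : ∃ y z, G.Adj x y ∧ G.Adj x z ∧ G.Adj y z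
  · obtain ⟨y, z, hxy, hxz, hyz⟩ := htri
    have hW := ih (Nat.card {v // v ≠ y}) (hcard {v | v ≠ y} y (by simp)) rfl
      (contraction G x y hxy.ne) (fun c => p (c.1.1, c.2)) (hsub {v | v ≠ y})
      (fun h => hG (h.of_contraction hp hxy hxz hyz)) ⟨x, hxy.ne⟩
    rcases hW with ⟨X, C, hxX, hX, hC⟩ | ⟨C, hC⟩
    · left
      -- The merged vertex is not in `X`, so `X` lifts unchanged and stays stable; taking the
      -- preimage of `C` puts x and y on the same side.
      refine ⟨Subtype.val '' X, {v | mergeMap x y hxy.ne v ∈ C}, ?_, ?_, ?_, ?_, ?_, ?_⟩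
      · rintro ⟨v, hv, rfl⟩
        exact hxX hv
      · rintro _ ⟨u, hu, rfl⟩ _ ⟨v, hv, rfl⟩ huv huv'
        exact hX hu hv (fun e => huv (congrArg _ e)) (contraction_adj_of_ne hxy.ne huv' u.2 v.2)
      · rintro _ hu ⟨v, hv, rfl⟩
        refine hC.disjoint v ?_ hv
        simpa [mergeMap_of_ne hxy.ne v.2] using hu
      · obtain ⟨u, hu⟩ := hC.nonempty
        exact ⟨u, by simpa [mergeMap_of_ne hxy.ne u.2] using hu⟩
      · obtain ⟨u, hu, huX⟩ := hC.nonempty_compl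
        refine ⟨u, by simpa [mergeMap_of_ne hxy.ne u.2] using hu, ?_⟩
        rintro ⟨v, hv, hvu⟩
        exact huX (Subtype.ext hvu ▸ hv)
      · intro u hu v hv hvX huv
        refine hC.not_adj _ hu _ hv ?_ (contraction_adj hxy.ne huv fun e =>
        hv (by rw [Set.mem_ofPred_eq, ← e]; exact hu))
        by_cases hvy : v = y
        · rw [hvy, mergeMap_self]; exact hxX
        · rw [mergeMap_of_ne _ hvy]
          exact fun h => hvX ⟨_, h, rfl⟩
    -- The merged vertex is a cut vertex of the contraction, so {x, y} separates `C₀` from the rest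
    -- of G.
    · have hxC : (⟨x, hxy.ne⟩ : {v // v ≠ y}) ∉ C := fun h => hC.disjoint _ h rfl
      set C₀ : Set V := Subtype.val '' C with hC₀
      have hxC₀ : x ∉ C₀ := by rintro ⟨v, hv, rfl⟩; exact hxC hv
      have hyC₀ : y ∉ C₀ := by rintro ⟨v, hv, hvy⟩; exact v.2 hvy
      have hadj : ∀ u ∈ C₀, ∀ v ∉ C₀, v ≠ x → v ≠ y → ¬ G.Adj u v := by
        rintro _ ⟨u, hu, rfl⟩ v hv hvx hvy huv
        refine hC.not_adj u hu ⟨v, hvy⟩ (fun h => hv ⟨_, h, rfl⟩)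
          (fun h => hvx (congrArg Subtype.val h)) (contraction_adj_of_ne hxy.ne huv u.2 hvy)
      obtain ⟨a, ha⟩ := hC.nonempty
      obtain ⟨b, hb, hbx⟩ := hC.nonempty_compl
      set S : Set V := C₀ ∪ {x, y} with hS
      set T : Set V := C₀ᶜ with hT
      have hbS : b.1 ∉ S := by
        rintro (⟨v, hv, hvb⟩ | hbx' | hby)
        · exact hb (Subtype.ext hvb ▸ hv)
        · exact hbx (Subtype.ext hbx')
        · exact b.2 hby
      have haT : a.1 ∉ T := fun h => h ⟨a, ha, rfl⟩
      have key : ∀ U : Set V, x ∈ U → y ∈ U → (∃ v, v ∉ U) →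
          (∀ u ∈ U, u ≠ x → u ≠ y → ∀ v ∉ U, ¬ G.Adj u v) →
          ¬ InfRigid (G.induce U) (fun c => p (c.1.1, c.2)) →
          (∃ X C : Set V, x ∉ X ∧ G.IsIndepSet X ∧ Separates G X C) ∨
            ∃ C, Separates G {x} C := by
        rintro U hxU hyU ⟨v, hv⟩ hU hflex
        rcases ih (Nat.card U) (hcard U v hv) rfl (G.induce U) _ (hsub U) hflex ⟨x, hxU⟩ with
          ⟨X, C, hxX, hX, hC⟩ | ⟨C, hC⟩
        · obtain ⟨C', hC'⟩ := hC.of_induce hxU hyU hxy hU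
          refine Or.inl ⟨_, C', ?_, ?_, hC'⟩
          · rintro ⟨v, hv, rfl⟩
            exact hxX hv
          · rintro _ ⟨u, hu, rfl⟩ _ ⟨v, hv, rfl⟩ huv huv'
            exact hX hu hv (fun e => huv (congrArg _ e)) (by simpa using huv')
        · obtain ⟨C', hC'⟩ := hC.of_induce hxU hyU hxy hU
          rw [Set.image_singleton] at hC'
          exact Or.inr ⟨C', hC'⟩
      by_cases hSr : InfRigid (G.induce S) (fun c => p (c.1.1, c.2))
      · refine key T hxC₀ hyC₀ ⟨a, haT⟩ ?_ fun hTr => hG ?_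
        · intro u hu hux huy v hv huv
          exact hadj v (not_not.1 hv) u hu hux huy huv.symm
        · refine InfRigid.glue hp (S := S) (T := T) ?_ hxy.ne (by simp [hS]) (by simp [hS])
            hxC₀ hyC₀ hSr hTr
          ext v
          by_cases hv : v ∈ C₀ <;> simp [hS, hT, hv]
      · refine key S (by simp [hS]) (by simp [hS]) ⟨b, hbS⟩ ?_ hSr
        rintro u (hu | hu) hux huy v hv huv
        · exact hadj u hu v (fun h => hv (Or.inl h)) (fun h => hv (by simp [hS, h]))
            (fun h => hv (by simp [hS, h])) huv
        · rcases hu with hu | hu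
          · exact hux hu
          · exact huy hu
  · push Not at htri
    by_cases hdom : ∀ v, v ≠ x → G.Adj x v
    · by_cases hab : ∃ a b, a ≠ x ∧ b ≠ x ∧ a ≠ b
      · obtain ⟨a, b, ha, hb, hne⟩ := hab
        refine Or.inr ⟨{a}, ?_, ⟨a, rfl⟩, ⟨b, fun h => hne h.symm, hb⟩, ?_⟩
        · rintro u rfl; exact ha
        · rintro u rfl v - hv
          exact htri u v (hdom u ha) (hdom v hv)
      · exfalso
        push Not at hab
        refine hG fun q hq u v => ?_
        by_cases huv : u = v
        · simp [huv, edgeForm]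
        · refine hq u v ?_
          by_cases hu : u = x
          · subst hu; exact hdom v (Ne.symm huv)
          · by_cases hv : v = x
            · subst hv; exact (hdom u hu).symm
            · exact absurd (hab u v hu hv) huv
    · push Not at hdom
      obtain ⟨b, hbx, hb⟩ := hdom
      -- The neighbourhood of x is stable because x lies in no triangle, and it isolates x from the
      -- non-neighbour `b`.
      refine Or.inl ⟨{v | G.Adj x v}, {x}, ?_, ?_, ?_, ⟨x, rfl⟩, ⟨b, hbx, hb⟩, ?_⟩
      · simp
      · intro u hu v hv _
        exact htri u v hu hv
      · rintro u rfl; simp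
      · rintro u rfl v - hv; exact hv


/-! ### From infinitesimal rigidity to rigidity -/

/-- Two families of vectors with the same norms of linear combinations differ by a linear
isometry. -/
lemma exists_linearIsometry_of_norm_eq {ι E : Type*} [NormedAddCommGroup E]
    [InnerProductSpace ℝ E] [FiniteDimensional ℝ E] (a b : ι → E)
    (h : ∀ c : ι →₀ ℝ, ‖Finsupp.linearCombination ℝ a c‖ = ‖Finsupp.linearCombination ℝ b c‖) :
    ∃ L : E →ₗᵢ[ℝ] E, ∀ i, L (a i) = b i := by
  -- A linear choice `s` of coefficients for vectors in the span of `a`; equality of norms makes the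
  -- resulting vector in the span of `b` independent of the choice.
  obtain ⟨s, hs⟩ := (Finsupp.linearCombination ℝ a).rangeRestrict.exists_rightInverse_of_surjective
    (LinearMap.range_rangeRestrict _)
  have hs' : ∀ w, Finsupp.linearCombination ℝ a (s w) = (w : E) := fun w =>
    congrArg Subtype.val (LinearMap.congr_fun hs w)
  let L : LinearMap.range (Finsupp.linearCombination ℝ a) →ₗᵢ[ℝ] E :=
    { toLinearMap := (Finsupp.linearCombination ℝ b).comp s
      norm_map' := fun w => by
        rw [LinearMap.comp_apply, ← h, hs']
        rfl }
  refine ⟨L.extend, fun i => ?_⟩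
  have hi : Finsupp.linearCombination ℝ a (Finsupp.single i 1) = a i := by simp
  have hi' : Finsupp.linearCombination ℝ b (Finsupp.single i 1) = b i := by simp
  have := L.extend_apply ⟨a i, Finsupp.single i 1, hi⟩
  rw [this, ← sub_eq_zero, ← norm_eq_zero, ← hi']
  change ‖Finsupp.linearCombination ℝ b (s _) - _‖ = 0
  rw [← map_sub, ← h, map_sub, hs', hi, sub_self, norm_zero]

/-- Congruent families in a Euclidean space are related by an isometry of the space. -/
lemma exists_linearIsometry_of_congruent {ι E : Type*} [NormedAddCommGroup E]
    [InnerProductSpace ℝ E] [FiniteDimensional ℝ E] {p r : ι → E} (h : Congruent r p) (x : ι) :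
    ∃ L : E →ₗᵢ[ℝ] E, ∀ i, L (r i - r x) = p i - p x := by
  have hn : ∀ i j, ‖r i - r j‖ = ‖p i - p j‖ := fun i j => by
    simpa [dist_eq_norm] using h.dist_eq i j
  have hin : ∀ i j, inner ℝ (r i - r x) (r j - r x) = inner ℝ (p i - p x) (p j - p x) := by
    intro i j
    rw [real_inner_eq_norm_mul_self_add_norm_mul_self_sub_norm_sub_mul_self_div_two,
      real_inner_eq_norm_mul_self_add_norm_mul_self_sub_norm_sub_mul_self_div_two,
      sub_sub_sub_cancel_right, sub_sub_sub_cancel_right, hn, hn, hn]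
  refine exists_linearIsometry_of_norm_eq _ _ fun c => ?_
  rw [← sq_eq_sq₀ (norm_nonneg _) (norm_nonneg _), ← real_inner_self_eq_norm_sq,
    ← real_inner_self_eq_norm_sq]
  simp only [Finsupp.linearCombination_apply, Finsupp.sum, sum_inner, inner_sum,
    real_inner_smul_left, real_inner_smul_right, hin]

/-- The coordinates of a plane realisation. -/
def coords {V : Type*} (p : Realisation V 2) : V × Fin 2 → ℝ := fun c => p c.1 c.2

/-- The averaging trick: a difference of squares factors, so p and q are equivalent exactly when p -
q is an infinitesimal motion of p + q, or equally of their midpoint. Near an infinitesimally rigid p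
that midpoint is infinitesimally rigid too. -/
lemma norm_sub_eq_iff {V : Type*} (p q : Realisation V 2) (u v : V) :
    ‖p u - p v‖ = ‖q u - q v‖ ↔
      edgeForm (coords p + coords q) (coords p - coords q) u v = 0 := by
  rw [← sq_eq_sq₀ (norm_nonneg _) (norm_nonneg _), EuclideanSpace.norm_sq_eq,
    EuclideanSpace.norm_sq_eq]
  simp only [Fin.sum_univ_two, edgeForm, coords, Real.norm_eq_abs, sq_abs, Pi.add_apply,
    Pi.sub_apply, PiLp.sub_apply]
  constructor <;> intro h <;> linear_combination h

lemma continuous_coords {V : Type*} : Continuous (coords : Realisation V 2 → V × Fin 2 → ℝ) := by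
  unfold coords
  fun_prop

/-- Near an infinitesimally rigid generic realisation, equivalent realisations are congruent. -/
lemma eventually_congruent {V : Type*} [Finite V] {G : SimpleGraph V} {p : Realisation V 2}
    (hp : IsGeneric p) (h : InfRigid G (coords p)) :
    ∀ᶠ q in nhds p, Equivalent G p q → Congruent p q := by
  have hp' : AlgebraicIndependent ℚ (coords p) := hp
  rcases subsingleton_or_nontrivial V with hV | hV
  · refine Filter.Eventually.of_forall fun q _ u v => ?_
    rw [Subsingleton.elim u v, edist_self, edist_self]
  obtain ⟨x, y, hxy⟩ := exists_pair_ne V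
  have hopen : IsOpen {m : V × Fin 2 → ℝ | PinnedInfRigid G m x y ∧ m (x, 1) ≠ m (y, 1)} :=
    (isOpen_pinnedInfRigid G x y).inter
      (isOpen_ne_fun (continuous_apply _) (continuous_apply _))
  have hcont : Continuous fun q : Realisation V 2 =>
      (2⁻¹ : ℝ) • (coords p + coords q) :=
    ((continuous_const (y := coords p)).add continuous_coords).const_smul (2⁻¹ : ℝ)
  have hmem : (2⁻¹ : ℝ) • (coords p + coords p) ∈
      {m : V × Fin 2 → ℝ | PinnedInfRigid G m x y ∧ m (x, 1) ≠ m (y, 1)} := by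
    rw [← two_smul ℝ, smul_smul, inv_mul_cancel₀ two_ne_zero, one_smul]
    exact ⟨h.pinned hp' hxy, generic_ne hp' hxy 1⟩
  filter_upwards [hcont.continuousAt.eventually (hopen.mem_nhds hmem)] with q hq hequiv
  have hrig := PinnedInfRigid.infRigid hq.1 hq.2
  have hscale : ∀ u v, edgeForm ((2⁻¹ : ℝ) • (coords p + coords q)) (coords p - coords q) u v =
      2⁻¹ * edgeForm (coords p + coords q) (coords p - coords q) u v := by
    intro u v
    simp only [edgeForm, Pi.smul_apply, smul_eq_mul]
    ring
  refine Congruent.of_dist_eq fun u v => ?_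
  rw [dist_eq_norm, dist_eq_norm, norm_sub_eq_iff]
  have := hrig (coords p - coords q) (fun u v huv => by
    rw [hscale, (norm_sub_eq_iff p q u v).1 (hequiv u v huv), mul_zero]) u v
  rw [hscale] at this
  simpa using this

/-- Infinitesimally rigid generic frameworks in the plane are rigid. -/
theorem InfRigid.isRigidFramework {V : Type*} [Finite V] {G : SimpleGraph V}
    {p : Realisation V 2} (hp : IsGeneric p) (h : InfRigid G (coords p)) :
    IsRigidFramework G p := by
  rintro ⟨φ, hφ, hnt⟩
  refine hnt fun t ht => ?_
  rcases isEmpty_or_nonempty V with hV | ⟨⟨x⟩⟩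
  · exact fun u _ => hV.elim u
  have hφc : Continuous fun s : Set.Ioo (-1 : ℝ) 1 => φ s :=
    continuousOn_iff_continuous_domRestrict.1 hφ.continuousOn
  let A : Set (Set.Ioo (-1 : ℝ) 1) := {s | Congruent p (φ s)}
  have hclosed : IsClosed A := by
    have : A = ⋂ u, ⋂ v, {s : Set.Ioo (-1 : ℝ) 1 | edist (p u) (p v) =
        edist (φ s u) (φ s v)} := by
      ext s
      simp [A, Congruent]
    rw [this]
    refine isClosed_iInter fun u => isClosed_iInter fun v => isClosed_eq continuous_const ?_
    exact ((continuous_apply u).comp hφc).edist ((continuous_apply v).comp hφc)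
  -- Local rigidity is known only near `p`. For a time s in `A`, an isometry carries `φ s` back to
  -- `p` and the nearby realisations to a neighbourhood of `p`. So `A` is clopen in a connected
  -- interval.
  have hopen : IsOpen A := by
    rw [isOpen_iff_mem_nhds]
    intro s hs
    obtain ⟨L, hL⟩ := exists_linearIsometry_of_congruent (Congruent.symm hs) x
    have hψ : Continuous fun (τ : Set.Ioo (-1 : ℝ) 1) (v : V) => p x + L (φ τ v - φ s x) :=
      continuous_pi fun v => continuous_const.add
        (L.continuous.comp (((continuous_apply v).comp hφc).sub continuous_const))
    have hψs : (fun v : V => p x + L (φ s v - φ s x)) = p := by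
      ext1 v
      rw [hL, add_sub_cancel]
    have hnorm : ∀ (τ : Set.Ioo (-1 : ℝ) 1) (u v : V),
        ‖(p x + L (φ τ u - φ s x)) - (p x + L (φ τ v - φ s x))‖ = ‖φ τ u - φ τ v‖ := by
      intro τ u v
      rw [add_sub_add_left_eq_sub, ← map_sub, L.norm_map, sub_sub_sub_cancel_right]
    have hev := (hψ.continuousAt (x := s)).eventually
      (p := fun q => Equivalent G p q → Congruent p q)
      (by beta_reduce; rw [hψs]; exact eventually_congruent hp h)
    filter_upwards [hev] with τ hτ
    have hcong := hτ fun u v huv => by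
      rw [hnorm]
      exact hφ.equivalent τ τ.2 u v huv
    refine Congruent.of_dist_eq fun u v => ?_
    rw [hcong.dist_eq u v, dist_eq_norm, dist_eq_norm, hnorm]
  have hconn : PreconnectedSpace (Set.Ioo (-1 : ℝ) 1) :=
    Subtype.preconnectedSpace isPreconnected_Ioo
  have h0 : (⟨0, by norm_num⟩ : Set.Ioo (-1 : ℝ) 1) ∈ A := by
    change Congruent p (φ 0)
    rw [hφ.initial]
  have huniv : A = Set.univ := IsClopen.eq_univ ⟨hclosed, hopen⟩ ⟨_, h0⟩
  have hmem : (⟨t, ht⟩ : Set.Ioo (-1 : ℝ) 1) ∈ A := by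
    rw [huniv]
    exact Set.mem_univ _
  exact hmem

end GraphRigidity

theorem corollary4p3 {V : Type*} [Finite V] (G : SimpleGraph V)
    (hG : GraphRigidity.IsFlexibleGraph 2 G) :
    ∃ X : Set V, GraphRigidity.IsStableCut G X := by
  obtain ⟨p, hp, hflex⟩ : ∃ p, GraphRigidity.IsGeneric p ∧
      ¬ GraphRigidity.IsRigidFramework G p := by
    simpa [GraphRigidity.IsFlexibleGraph, GraphRigidity.IsRigidGraph] using hG
  have hinf : ¬ GraphRigidity.InfRigid G (GraphRigidity.coords p) :=
    fun h => hflex (h.isRigidFramework hp)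
  rcases isEmpty_or_nonempty V with hV | ⟨⟨x⟩⟩
  · exact absurd (fun q _ u => hV.elim u) hinf
  rcases GraphRigidity.exists_separates_of_not_infRigid _ rfl G _ hp hinf x with
    ⟨X, C, -, hX, hC⟩ | ⟨C, hC⟩
  · exact ⟨X, hX, hC.isCut⟩
  · exact ⟨{x}, by simp [SimpleGraph.IsIndepSet], hC.isCut⟩
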